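/- For positive integers $\beta_1,\dots,\beta_k$ with $\beta_k\ge 2$, let $$\zeta(\beta_1,\dots,\beta_k)=\sum_{1\le j_1<j_2<\cdots<j_k} j_1^{-\beta_1}j_2^{-\beta_2}\cdots j_k^{-\beta_k}$$ be the multiple zeta value, and let $B_j(x)$ denote the $j$-th Bernoulli polynomial, defined by $\frac{te^{xt}}{e^t-1}=\sum_{j\ge 0}B_j(x)\frac{t^j}{j!}$. For integers $1\le k\le n$ put $$E(4n,k)=\sum_{\substack{\alpha_1+\cdots+\alpha_k=n\\ \alpha_i\ge 1}}\zeta(4\alpha_1,4\alpha_2,\dots,4\alpha_k).$$ **Theorem C.** For all integers $n,k$ with $1\le k\le n$, all the series $\zeta(4\alpha_1,\dots,4\alpha_k)$ above converge, and $$E(4n,k)=\frac{2^{2n+1}\pi^{4n}}{(4n+2)!}\sum_{q=0}^{n-k}(-1)^{n-q-k}\binom{n-q}{k}\binom{4n+2}{4q}\sum_{\substack{q_1+q_2=2q\\ q_1,q_2\ge 0}}\binom{4q}{2q_1}(-1)^{q_1}2^{2q}\,B_{2q_1}\!\left(\tfrac12\right)B_{2q_2}\!\left(\tfrac12\right).$$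 -/

import Mathlib

/-- The term `k₁^{-α₁} ⋯ k_r^{-α_r}` of the series `ζ(α₁, …, α_r)` that belongs to the
positive integers `k₁ < ⋯ < k_r`, given as an order embedding `Fin r ↪o ℕ+`. -/
noncomputable def mzvTerm {r : ℕ} (α : Fin r → ℕ) (s : Fin r ↪o ℕ+) : ℝ :=
  ∏ i, (((s i : ℕ) : ℝ) ^ α i)⁻¹

/-- The multiple zeta value `ζ(α₁, …, α_r) = ∑_{1 ≤ k₁ < ⋯ < k_r} k₁^{-α₁} ⋯ k_r^{-α_r}`. -/
noncomputable def multipleZeta {r : ℕ} (α : Fin r → ℕ) : ℝ :=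
  ∑' s : Fin r ↪o ℕ+, mzvTerm α s

/-- The `k`-tuples `(α₁, …, α_k)` of positive integers with `α₁ + ⋯ + α_k = n`. -/
def posTuples (n k : ℕ) : Finset (Fin k → ℕ) :=
  (Finset.piAntidiag Finset.univ n).filter fun α => ∀ i, 0 < α i

/-- `E(mn, k)`: the sum of all multiple zeta values `ζ(mα₁, …, mα_k)` of depth `k` and weight
`mn` all of whose arguments are multiples of `m`. -/
noncomputable def mzvSum (m n k : ℕ) : ℝ :=
  ∑ α ∈ posTuples n k, multipleZeta fun i => m * α i

/-- The value `B_j(1/2)` of the `j`-th Bernoulli polynomial, as a real number. -/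
noncomputable def bernoulliHalf (j : ℕ) : ℝ :=
  ((Polynomial.bernoulli j).eval (1 / 2 : ℚ) : ℚ)

/-! Put x_j = j⁻⁴. The series in X generating the sums of depth k is the coefficient of Y^k in ∏ (1
+ Y x_j X / (1 - x_j X)). Multiplying by P = ∏ (1 - x_j X) gives ∏ (1 + (Y - 1) x_j X), whose X^m
Y^k coefficient is (-1)^(m-k) C(m,k) e_m(x) (`mzvSumSeries_mul_quarticProd`). It remains to know P
and 1/P. As 1 - X²/j⁴ = (1 - X/j²)(1 + X/j²), Euler's sine product gives P(X²) = S(π²X) S(-π²X),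
where S(X) = sinh √X / √X, and 1/S has the values B_{2m}(1/2) in its coefficients
(`sinhSeries_mul_invSinhSeries`). All identities are proved for finite products of formal power
series and pass to the limit coefficient by coefficient. -/

open PowerSeries in
/-- The even part of a power series, as a series in `X ^ 2`. -/
noncomputable def evenPart (G : ℝ⟦X⟧) : ℝ⟦X⟧ := PowerSeries.mk fun n => coeff (2 * n) G

-- A factor in X² preserves the parity of exponents, so the even part is linear over such series.
open PowerSeries in
theorem evenPart_expand_mul (F G : ℝ⟦X⟧) :
    evenPart (expand 2 two_ne_zero F * G) = F * evenPart G := by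
  ext n
  rw [evenPart, coeff_mk, coeff_mul, coeff_mul]
  symm
  refine Finset.sum_of_injOn (fun p => (2 * p.1, 2 * p.2)) ?_ ?_ ?_ ?_
  · rintro ⟨a, b⟩ _ ⟨c, d⟩ _ h
    simp only [Prod.mk.injEq] at h ⊢
    omega
  · rintro ⟨a, b⟩ h
    simp only [Finset.mem_coe, Finset.HasAntidiagonal.mem_antidiagonal] at h ⊢
    omega
  · rintro ⟨a, b⟩ h h'
    rw [Finset.HasAntidiagonal.mem_antidiagonal] at h
    simp only at h
    rw [coeff_expand_of_not_dvd, zero_mul]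
    rintro ⟨c, rfl⟩
    apply h'
    refine ⟨(c, n - c), ?_, ?_⟩
    · simp only [Finset.mem_coe, Finset.HasAntidiagonal.mem_antidiagonal]
      omega
    · simp only [Prod.mk.injEq, true_and]
      omega
  · rintro ⟨a, b⟩ _
    simp [evenPart]

theorem evenPart_one : evenPart 1 = 1 := by
  ext n
  simp [evenPart, PowerSeries.coeff_one]

/-! ### Elementary symmetric functions and finite products -/

open Polynomial in
theorem Finset.prod_one_add_X_mul_C_coeff {R ι : Type*} [CommRing R] (g : ι → R) (U : Finset ι)
    (k : ℕ) :
    (∏ j ∈ U, (1 + X * C (g j))).coeff k = ∑ S ∈ U.powersetCard k, ∏ j ∈ S, g j := by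
  classical
  rw [Finset.prod_one_add, finsetSum_coeff, Finset.powersetCard_eq_filter, Finset.sum_filter]
  refine Finset.sum_congr rfl fun S _ => ?_
  rw [Finset.prod_mul_distrib, Finset.prod_const, ← map_prod, mul_comm, coeff_C_mul_X_pow]
  simp only [eq_comm]

open Polynomial in
/-- The coefficient of `Y ^ k` in `∏ (1 + Y g) (1 - c) = ∏ (1 + (Y - 1) c)`. -/
theorem Finset.sum_powersetCard_prod_mul_prod_one_sub {R ι : Type*} [CommRing R] (g c : ι → R)
    (h : ∀ j, g j * (1 - c j) = c j) (U : Finset ι) (k : ℕ) :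
    (∑ S ∈ U.powersetCard k, ∏ j ∈ S, g j) * ∏ j ∈ U, (1 - c j) =
      ∑ T ∈ U.powerset, (-1) ^ (T.card - k) * (T.card.choose k : R) * ∏ j ∈ T, c j := by
  have key : (∏ j ∈ U, (1 + X * C (g j))) * C (∏ j ∈ U, (1 - c j)) =
      ∏ j ∈ U, (1 + (X - C 1) * C (c j)) := by
    rw [map_prod, ← Finset.prod_mul_distrib]
    refine Finset.prod_congr rfl fun j _ => ?_
    have : C (g j) * (1 - C (c j)) = C (c j) := by
      rw [← map_one C, ← map_sub, ← map_mul, h j]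
    simp only [map_sub, map_one]
    linear_combination X * this
  have := congrArg (fun p => coeff p k) key
  simp only [coeff_mul_C, Finset.prod_one_add_X_mul_C_coeff] at this
  rw [this, Finset.prod_one_add, finsetSum_coeff]
  refine Finset.sum_congr rfl fun T _ => ?_
  rw [Finset.prod_mul_distrib, Finset.prod_const, ← map_prod, coeff_mul_C, sub_eq_add_neg,
    ← map_neg, coeff_X_add_C_pow]

open PowerSeries in
theorem PowerSeries.coeff_prod_one_add_C_mul_X {R ι : Type*} [CommRing R] (f : ι → R)
    (U : Finset ι) (m : ℕ) :
    coeff m (∏ j ∈ U, (1 + C (f j) * X)) = ∑ S ∈ U.powersetCard m, ∏ j ∈ S, f j := by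
  classical
  rw [Finset.prod_one_add, map_sum, Finset.powersetCard_eq_filter, Finset.sum_filter]
  refine Finset.sum_congr rfl fun S _ => ?_
  rw [Finset.prod_mul_distrib, Finset.prod_const, ← map_prod, coeff_C_mul, coeff_X_pow]
  simp [eq_comm]

open PowerSeries in
/-- The series `x X + x² X² + ⋯`. -/
noncomputable def geomTail (x : ℝ) : ℝ⟦X⟧ := PowerSeries.mk fun a => if a = 0 then 0 else x ^ a

open PowerSeries in
theorem geomTail_mul (x : ℝ) : geomTail x * (1 - C x * X) = C x * X := by
  ext n
  rw [mul_sub, mul_one, mul_left_comm, map_sub, coeff_C_mul, coeff_C_mul]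
  rcases n with _ | _ | n
  · simp [geomTail]
  · simp [geomTail, coeff_succ_mul_X]
  · simp [geomTail, coeff_X, pow_succ, mul_comm]

-- With c_j = x_j X, each subset T contributes a monomial of degree |T|, so fixing the degree m
-- leaves only the subsets of size m.
open PowerSeries in
theorem coeff_sum_prod_geomTail_mul {ι : Type*} (x : ι → ℝ) (U : Finset ι) (k m : ℕ) :
    coeff m ((∑ S ∈ U.powersetCard k, ∏ j ∈ S, geomTail (x j)) *
        ∏ j ∈ U, (1 + C (-x j) * X)) =
      (-1) ^ (m - k) * (m.choose k : ℝ) * ∑ S ∈ U.powersetCard m, ∏ j ∈ S, x j := by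
  classical
  have : ∀ j, (1 + C (-x j) * X : ℝ⟦X⟧) = 1 - C (x j) * X := fun j => by
    rw [map_neg]; ring
  simp_rw [this]
  rw [Finset.sum_powersetCard_prod_mul_prod_one_sub _ _ (fun j => geomTail_mul (x j)), map_sum,
    Finset.powersetCard_eq_filter, Finset.sum_filter, Finset.mul_sum]
  refine Finset.sum_congr rfl fun T _ => ?_
  rw [Finset.prod_mul_distrib, Finset.prod_const, ← map_prod,
    show ((-1) ^ (T.card - k) * (T.card.choose k : ℝ⟦X⟧)) * (C (∏ j ∈ T, x j) * X ^ T.card) =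
      C ((-1) ^ (T.card - k) * (T.card.choose k : ℝ) * ∏ j ∈ T, x j) * X ^ T.card by
      simp only [map_mul, map_pow, map_neg, map_one, map_natCast]; ring, coeff_C_mul, coeff_X_pow]
  by_cases hT : T.card = m
  · simp [hT]
  · simp [hT, Ne.symm hT]

open PowerSeries in
theorem PowerSeries.prod_one_add_mul_prod_one_sub {ι : Type*} (a : ι → ℝ) (U : Finset ι) :
    (∏ j ∈ U, (1 + C (a j) * X)) * ∏ j ∈ U, (1 + C (-a j) * X) =
      expand 2 two_ne_zero (∏ j ∈ U, (1 + C (-(a j ^ 2)) * X)) := by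
  rw [← Finset.prod_mul_distrib, map_prod]
  refine Finset.prod_congr rfl fun j _ => ?_
  simp only [map_add, map_mul, map_one, expand_X, expand_C, map_neg, map_pow]
  ring

/-! ### Bernoulli values at 1/2 and the inverse of sinh √X / √X -/

-- At x = 1/2 the generating function t e^(t/2) / (e^t - 1) becomes t / (e^(t/2) - e^(-t/2)).
open PowerSeries in
theorem PowerSeries.mk_bernoulliHalf_mul :
    (PowerSeries.mk fun n => bernoulliHalf n / (n.factorial : ℝ)) *
      (rescale (1 / 2 : ℝ) (exp ℝ) - rescale (-1 / 2 : ℝ) (exp ℝ)) = X := by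
  have h := Polynomial.bernoulli_generating_function (A := ℝ) (1 / 2)
  have hB : (PowerSeries.mk fun n => Polynomial.aeval (1 / 2 : ℝ)
      ((1 / n.factorial : ℚ) • Polynomial.bernoulli n)) =
      (PowerSeries.mk fun n => bernoulliHalf n / (n.factorial : ℝ)) := by
    ext n
    have : Polynomial.aeval (1 / 2 : ℝ) (Polynomial.bernoulli n) = bernoulliHalf n := by
      have := Polynomial.aeval_algebraMap_apply ℝ (1 / 2 : ℚ) (Polynomial.bernoulli n)
      simpa [bernoulliHalf] using this
    rw [coeff_mk, coeff_mk, map_smul, this]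
    simp [Rat.smul_def]
    ring
  rw [hB] at h
  have e1 : rescale (1 / 2 : ℝ) (exp ℝ) * rescale (-1 / 2 : ℝ) (exp ℝ) = 1 := by
    rw [exp_mul_exp_eq_exp_add]; ext n; norm_num [coeff_rescale, coeff_one]
  have e2 : exp ℝ * rescale (-1 / 2 : ℝ) (exp ℝ) = rescale (1 / 2 : ℝ) (exp ℝ) := by
    have := exp_mul_exp_eq_exp_add (A := ℝ) 1 (-1 / 2)
    rw [rescale_one] at this
    norm_num at this ⊢
    exact this
  calc _ = (PowerSeries.mk fun n => bernoulliHalf n / (n.factorial : ℝ)) * (exp ℝ - 1) *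
        rescale (-1 / 2 : ℝ) (exp ℝ) := by rw [mul_assoc, sub_mul, e2, one_mul]
    _ = _ := by rw [h, mul_assoc, e1, mul_one]

/-- The series `sinh √X / √X`. -/
noncomputable def sinhSeries : PowerSeries ℝ :=
  PowerSeries.mk fun m => 1 / ((2 * m + 1).factorial : ℝ)

/-- The series `√X / sinh √X`. -/
noncomputable def invSinhSeries : PowerSeries ℝ :=
  PowerSeries.mk fun m => 2 ^ (2 * m) * bernoulliHalf (2 * m) / ((2 * m).factorial : ℝ)

open PowerSeries in
theorem sinhSeries_mul_invSinhSeries : sinhSeries * invSinhSeries = 1 := by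
  have h := congrArg (rescale (2 : ℝ)) mk_bernoulliHalf_mul
  rw [map_mul, map_sub, rescale_rescale, rescale_rescale, rescale_X] at h
  have hS : rescale (1 / 2 * 2 : ℝ) (exp ℝ) - rescale (-1 / 2 * 2 : ℝ) (exp ℝ) =
      C 2 * X * expand 2 two_ne_zero sinhSeries := by
    ext n
    rw [mul_assoc, coeff_C_mul]
    rcases n with _ | n
    · rw [coeff_zero_X_mul]
      norm_num [← coeff_zero_eq_constantCoeff_apply, coeff_rescale, -coeff_zero_eq_constantCoeff]
    · rw [coeff_succ_X_mul, coeff_expand]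
      norm_num [coeff_rescale, coeff_exp, sinhSeries]
      split_ifs with hn
      · obtain ⟨c, rfl⟩ := hn
        simp [pow_succ, pow_mul]
        ring
      · have : Odd n := by simpa [← Nat.not_even_iff_odd, even_iff_two_dvd] using hn
        have : Even (n + 1) := this.add_one
        simp [this.neg_one_pow]
  rw [hS] at h
  have hX : (C 2 * X : PowerSeries ℝ) ≠ 0 := by
    intro h0
    have := congrArg (coeff 1) h0
    simp at this
  have h1 : expand 2 two_ne_zero sinhSeries *
      rescale (2 : ℝ) (PowerSeries.mk fun n => bernoulliHalf n / (n.factorial : ℝ)) = 1 := by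
    apply mul_left_cancel₀ hX
    rw [mul_one]
    exact (by ring : _ = _).trans h
  -- Taking even parts avoids having to show that B_j(1/2) = 0 for odd j.
  have h2 := congrArg evenPart h1
  rw [evenPart_expand_mul, evenPart_one] at h2
  rw [← h2]
  congr 1
  ext n
  simp [invSinhSeries, evenPart, coeff_rescale]
  ring

/-! ### The quartic product and its inverse -/

/-- The limit of the products `∏ (1 - X / j ^ 4)`, namely `sin (π x) sinh (π x) / (π x) ^ 2` with
`x ^ 4 = X`. -/
noncomputable def quarticProd : PowerSeries ℝ :=
  PowerSeries.mk fun m =>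
    (-1) ^ m * (2 ^ (2 * m + 1) * Real.pi ^ (4 * m) / ((4 * m + 2).factorial : ℝ))

/-- Both sides are the imaginary part of (1 + i)^(4m+2) = (2i)^(2m+1). -/
theorem sum_antidiagonal_neg_one_pow_choose (m : ℕ) :
    ∑ p ∈ Finset.HasAntidiagonal.antidiagonal (2 * m),
        (-1 : ℝ) ^ p.1 * ((4 * m + 2).choose (2 * p.1 + 1) : ℝ) =
      (-1) ^ m * 2 ^ (2 * m + 1) := by
  have h : ((1 + Complex.I) ^ 2) ^ (2 * m + 1) = 2 ^ (2 * m + 1) * (-1) ^ m * Complex.I := by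
    have : (1 + Complex.I) ^ 2 = 2 * Complex.I := by
      linear_combination Complex.I_sq
    rw [this, mul_pow, pow_succ Complex.I, pow_mul Complex.I, Complex.I_sq]
    ring
  rw [← pow_mul, add_comm 1, add_pow] at h
  have h' := congrArg Complex.im h
  rw [Complex.im_sum] at h'
  have hr : (2 ^ (2 * m + 1) * (-1) ^ m * Complex.I).im = (-1) ^ m * 2 ^ (2 * m + 1) := by
    have : (2 ^ (2 * m + 1) * (-1) ^ m * Complex.I) =
      (((-1) ^ m * 2 ^ (2 * m + 1) : ℝ) : ℂ) * Complex.I := by push_cast; ring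
    rw [this]; simp [-Complex.ofReal_mul, -Complex.ofReal_pow]
  rw [hr] at h'
  rw [← h']
  refine Finset.sum_of_injOn (fun p => 2 * p.1 + 1) ?_ ?_ ?_ ?_
  · rintro ⟨a, b⟩ h ⟨c, d⟩ h' e
    simp only [Finset.mem_coe, Finset.HasAntidiagonal.mem_antidiagonal] at h h'
    simp only [Prod.mk.injEq] at e ⊢
    omega
  · rintro ⟨a, b⟩ h
    have := Finset.HasAntidiagonal.mem_antidiagonal.mp h
    simp only [Finset.mem_coe, Finset.mem_range] at *
    omega
  · intro i hi h'
    rcases Nat.even_or_odd' i with ⟨c, rfl | rfl⟩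
    · have : Complex.I ^ (2 * c) * 1 ^ (2 * (2 * m + 1) - 2 * c) *
          (((2 * (2 * m + 1)).choose (2 * c) : ℕ) : ℂ) =
          (((-1) ^ c * ((2 * (2 * m + 1)).choose (2 * c) : ℕ) : ℝ) : ℂ) := by
        rw [pow_mul, Complex.I_sq]; push_cast; simp
      rw [this, Complex.ofReal_im]
    · exfalso
      apply h'
      rw [Finset.mem_range] at hi
      exact ⟨(c, 2 * m - c), by simp; omega, rfl⟩
  · rintro ⟨a, b⟩ _
    have : Complex.I ^ (2 * a + 1) * 1 ^ (2 * (2 * m + 1) - (2 * a + 1)) *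
          (((2 * (2 * m + 1)).choose (2 * a + 1) : ℕ) : ℂ) =
          (((-1) ^ a * ((4 * m + 2).choose (2 * a + 1) : ℕ) : ℝ) : ℂ) * Complex.I := by
        rw [pow_succ, pow_mul, Complex.I_sq]; push_cast
        rw [show 2 * (2 * m + 1) = 4 * m + 2 by ring]; simp; ring
    simp only
    rw [this]; simp [-Complex.ofReal_mul, -Complex.ofReal_pow]

open PowerSeries in
theorem coeff_even_rescale_sinhSeries_mul (m : ℕ) :
    coeff (2 * m) (rescale (Real.pi ^ 2) sinhSeries * rescale (-Real.pi ^ 2) sinhSeries) =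
      coeff m quarticProd := by
  rw [mul_comm (rescale _ _), coeff_mul, quarticProd, coeff_mk]
  have hf : ((4 * m + 2).factorial : ℝ) ≠ 0 := by positivity
  rw [← mul_div_assoc, eq_div_iff hf, ← mul_assoc, ← sum_antidiagonal_neg_one_pow_choose,
    Finset.sum_mul, Finset.sum_mul]
  refine Finset.sum_congr rfl ?_
  rintro ⟨a, b⟩ h
  rw [Finset.HasAntidiagonal.mem_antidiagonal] at h
  simp only at h ⊢
  have hc := Nat.choose_mul_factorial_mul_factorial (show 2 * a + 1 ≤ 4 * m + 2 by omega)
  rw [show 4 * m + 2 - (2 * a + 1) = 2 * b + 1 by omega] at hc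
  rw [← hc]
  have ha : ((2 * a + 1).factorial : ℝ) ≠ 0 := by positivity
  have hb : ((2 * b + 1).factorial : ℝ) ≠ 0 := by positivity
  simp only [coeff_rescale, sinhSeries, coeff_mk]
  push_cast
  rw [neg_pow, show 4 * m = 2 * a + 2 * b by omega]
  field_simp
  ring

/-- The inverse of `quarticProd`. -/
noncomputable def quarticProdInv : PowerSeries ℝ :=
  evenPart (PowerSeries.rescale (-Real.pi ^ 2) invSinhSeries *
    PowerSeries.rescale (Real.pi ^ 2) invSinhSeries)

open PowerSeries in
theorem quarticProd_mul_quarticProdInv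
    (h : expand 2 two_ne_zero quarticProd =
      rescale (Real.pi ^ 2) sinhSeries * rescale (-Real.pi ^ 2) sinhSeries) :
    quarticProd * quarticProdInv = 1 := by
  rw [quarticProdInv, ← evenPart_expand_mul, h, ← evenPart_one]
  congr 1
  calc _ = rescale (Real.pi ^ 2) (sinhSeries * invSinhSeries) *
        rescale (-Real.pi ^ 2) (sinhSeries * invSinhSeries) := by
        rw [map_mul, map_mul]; ring
    _ = 1 := by rw [sinhSeries_mul_invSinhSeries]; simp

-- The two factors of 1/P give 2^(4q) in total; half of it stays outside the sum, to complete
-- 2^(2(n-q)+1) to 2^(2n+1) later.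
open PowerSeries in
theorem coeff_quarticProdInv (q : ℕ) :
    coeff q quarticProdInv = Real.pi ^ (4 * q) * 2 ^ (2 * q) / ((4 * q).factorial : ℝ) *
      ∑ p ∈ Finset.HasAntidiagonal.antidiagonal (2 * q),
        ((4 * q).choose (2 * p.1) : ℝ) * (-1 : ℝ) ^ p.1 * (2 : ℝ) ^ (2 * q) *
          bernoulliHalf (2 * p.1) * bernoulliHalf (2 * p.2) := by
  rw [quarticProdInv, evenPart, coeff_mk, coeff_mul, Finset.mul_sum]
  refine Finset.sum_congr rfl ?_
  rintro ⟨a, b⟩ h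
  rw [Finset.HasAntidiagonal.mem_antidiagonal] at h
  simp only at h ⊢
  have hc := Nat.choose_mul_factorial_mul_factorial (show 2 * a ≤ 4 * q by omega)
  rw [show 4 * q - 2 * a = 2 * b by omega] at hc
  have hch : ((4 * q).choose (2 * a) : ℝ) ≠ 0 := by
    exact_mod_cast (Nat.choose_pos (by omega)).ne'
  rw [← hc]
  have ha : ((2 * a).factorial : ℝ) ≠ 0 := by positivity
  have hb : ((2 * b).factorial : ℝ) ≠ 0 := by positivity
  simp only [coeff_rescale, invSinhSeries, coeff_mk]
  push_cast
  generalize ((4 * q).choose (2 * a) : ℝ) = c at hch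
  rw [neg_pow, show 4 * q = 2 * a + 2 * b by omega, ← h]
  field_simp
  ring

/-! ### Euler's product and coefficientwise limits -/

open Filter Topology

theorem tendsto_sum_powersetCard {ι : Type*} {g : Finset ι → ℝ} {m : ℕ} {L : ℝ}
    (h : HasSum (fun S => if S.card = m then g S else 0) L) :
    Tendsto (fun U : Finset ι => ∑ S ∈ U.powersetCard m, g S) atTop (𝓝 L) := by
  simp_rw [Finset.powersetCard_eq_filter, Finset.sum_filter]
  exact h.comp tendsto_finset_powerset_atTop_atTop

theorem HasSum.finset_card {ι : Type*} {g : Finset ι → ℂ} {L : ℂ} (h : HasSum g L) :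
    HasSum (fun m => ∑' S : Finset ι, if S.card = m then g S else 0) L := by
  have h1 := (Equiv.sigmaFiberEquiv (Finset.card : Finset ι → ℕ)).hasSum_iff.mpr h
  have h2 := h1.sigma fun m => (h1.summable.sigma_factor m).hasSum
  convert h2 using 2 with m
  rw [← tsum_subtype_eq_of_support_subset (s := {S : Finset ι | S.card = m})]
  · refine tsum_congr fun S => ?_
    exact if_pos S.2
  · intro S hS
    by_contra hS'
    exact hS (if_neg hS')

theorem hasSum_pow_mul_unique {a b : ℕ → ℂ} {f : ℂ → ℂ}
    (ha : ∀ z, HasSum (fun n => z ^ n * a n) (f z)) (hb : ∀ z, HasSum (fun n => z ^ n * b n) (f z)) :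
    a = b := by
  have key : ∀ c : ℕ → ℂ, (∀ z, HasSum (fun n => z ^ n * c n) (f z)) →
      HasFPowerSeriesAt f (FormalMultilinearSeries.ofScalars ℂ c) 0 := fun c hc => by
    rw [hasFPowerSeriesAt_iff]
    refine Eventually.of_forall fun z => ?_
    simpa using hc z
  have := (key a ha).eq_formalMultilinearSeries (key b hb)
  ext n
  simpa using congrArg (fun p => p.coeff n) this

theorem summable_inv_sq_pnat : Summable fun j : ℕ+ => (((j : ℕ) : ℝ) ^ 2)⁻¹ :=
  (Real.summable_nat_pow_inv.mpr one_lt_two).comp_injective PNat.coe_injective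

theorem tprod_one_sub_sq_div (z : ℂ) (hz : z ≠ 0) :
    ∏' j : ℕ+, (1 + -z ^ 2 * (((((j : ℕ) : ℝ) ^ 2)⁻¹ : ℝ) : ℂ)) =
      Complex.sin (Real.pi * z) / (Real.pi * z) := by
  have h := (multipliable_sineTerm z).hasProd.tendsto_prod_nat
  have h' := tendsto_nhds_unique h (tendsto_euler_sin_prod' hz)
  rw [← h', ← Equiv.pnatEquivNat.symm.tprod_eq]
  refine tprod_congr fun n => ?_
  simp [sineTerm, div_eq_mul_inv]

/-- The entire function ∏ (1 + w/j²) has two expansions in w: by elementary symmetric sums, and by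
the sine series. Their coefficients agree. -/
theorem hasSum_prod_inv_sq (m : ℕ) :
    HasSum (fun S : Finset ℕ+ => if S.card = m then ∏ j ∈ S, (((j : ℕ) : ℝ) ^ 2)⁻¹ else 0)
      (Real.pi ^ (2 * m) / ((2 * m + 1).factorial : ℝ)) := by
  set x : ℕ+ → ℝ := fun j => (((j : ℕ) : ℝ) ^ 2)⁻¹ with hx
  have hx0 : ∀ j, 0 ≤ x j := fun j => by positivity
  have hs : Summable fun S : Finset ℕ+ => ∏ j ∈ S, x j :=
    summable_finsetProd_of_summable_nonneg hx0 summable_inv_sq_pnat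
  have hm : ∀ m, Summable fun S : Finset ℕ+ => if S.card = m then ∏ j ∈ S, x j else 0 := fun m => by
    refine hs.of_nonneg_of_le (fun S => ?_) fun S => ?_ <;> split_ifs
    · exact Finset.prod_nonneg fun j _ => hx0 j
    · exact le_rfl
    · exact le_rfl
    · exact Finset.prod_nonneg fun j _ => hx0 j
  set e : ℕ → ℝ := fun m => ∑' S : Finset ℕ+, if S.card = m then ∏ j ∈ S, x j else 0 with he
  have h1 : ∀ w : ℂ, HasSum (fun m => w ^ m * (e m : ℂ)) (∏' j, (1 + w * (x j : ℂ))) := fun w => by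
    have hsw : Summable fun S : Finset ℕ+ => ∏ j ∈ S, (w * (x j : ℂ)) := by
      apply summable_finsetProd_of_summable_norm
      simp only [norm_mul, Complex.norm_real, Real.norm_of_nonneg (hx0 _)]
      exact summable_inv_sq_pnat.mul_left _
    rw [tprod_one_add hsw]
    convert hsw.hasSum.finset_card using 2 with m
    rw [he, Complex.ofReal_tsum, ← tsum_mul_left]
    refine tsum_congr fun S => ?_
    split_ifs with h
    · rw [Finset.prod_mul_distrib, Finset.prod_const, h, Complex.ofReal_prod]
    · simp
  have h2 : ∀ w : ℂ, HasSum
      (fun m => w ^ m * ((Real.pi ^ (2 * m) / ((2 * m + 1).factorial : ℝ) : ℝ) : ℂ))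
      (∏' j, (1 + w * (x j : ℂ))) := fun w => by
    by_cases hw : w = 0
    · subst hw
      convert hasSum_single (α := ℂ) 0 fun m hm => ?_ using 1
      · simp
      · simp [hm]
    -- Writing w = -z² turns the product into sin(πz)/(πz).
    · obtain ⟨z, hz⟩ := IsAlgClosed.exists_pow_nat_eq (-w) two_pos
      have hz0 : z ≠ 0 := by
        rintro rfl
        apply hw
        simpa using hz.symm
      have hw' : w = -z ^ 2 := by rw [hz]; ring
      rw [hw', tprod_one_sub_sq_div z hz0]
      have hpi : (Real.pi : ℂ) ≠ 0 := by exact_mod_cast Real.pi_ne_zero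
      have hsin := (Complex.hasSum_sin (Real.pi * z)).div_const (Real.pi * z)
      refine hsin.congr_fun fun m => ?_
      push_cast
      rw [neg_pow]
      field_simp
      ring
  have h3 := congrFun (hasSum_pow_mul_unique h1 h2) m
  rw [← Complex.ofReal_inj.mp h3]
  exact (hm m).hasSum

open PowerSeries in
theorem tendsto_coeff_mul {ι : Type*} {l : Filter ι} {P Q : ι → ℝ⟦X⟧} {p q : ℝ⟦X⟧}
    (hP : ∀ n, Tendsto (fun i => coeff n (P i)) l (𝓝 (coeff n p)))
    (hQ : ∀ n, Tendsto (fun i => coeff n (Q i)) l (𝓝 (coeff n q))) (n : ℕ) :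
    Tendsto (fun i => coeff n (P i * Q i)) l (𝓝 (coeff n (p * q))) := by
  simp_rw [coeff_mul]
  exact tendsto_finsetSum _ fun c _ => (hP _).mul (hQ _)

open PowerSeries in
theorem tendsto_coeff_prod_inv_sq (s : ℝ) (n : ℕ) :
    Tendsto (fun U : Finset ℕ+ =>
        coeff n (∏ j ∈ U, (1 + C (s * (((j : ℕ) : ℝ) ^ 2)⁻¹) * X : ℝ⟦X⟧)))
      atTop (𝓝 (coeff n (rescale (s * Real.pi ^ 2) sinhSeries))) := by
  simp_rw [coeff_prod_one_add_C_mul_X, coeff_rescale, sinhSeries, coeff_mk]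
  have h := (tendsto_sum_powersetCard (hasSum_prod_inv_sq n)).const_mul (s ^ n)
  convert h using 2 with U
  · rw [Finset.mul_sum]
    refine Finset.sum_congr rfl fun S hS => ?_
    rw [Finset.prod_mul_distrib, Finset.prod_const, (Finset.mem_powersetCard.mp hS).2]
  · rw [mul_pow, ← pow_mul]; ring

open PowerSeries in
theorem tendsto_coeff_expand_prod_inv_four (n : ℕ) :
    Tendsto (fun U : Finset ℕ+ =>
        coeff n (expand 2 two_ne_zero (∏ j ∈ U, (1 + C (-(((j : ℕ) : ℝ) ^ 4)⁻¹) * X : ℝ⟦X⟧))))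
      atTop (𝓝 (coeff n (rescale (Real.pi ^ 2) sinhSeries * rescale (-Real.pi ^ 2) sinhSeries))) := by
  have h := tendsto_coeff_mul (tendsto_coeff_prod_inv_sq 1) (tendsto_coeff_prod_inv_sq (-1)) n
  simp only [one_mul, neg_one_mul, prod_one_add_mul_prod_one_sub] at h
  convert h using 8 with U
  rw [inv_pow, ← pow_mul]

open PowerSeries in
theorem tendsto_coeff_prod_inv_four (n : ℕ) :
    Tendsto (fun U : Finset ℕ+ =>
        coeff n (∏ j ∈ U, (1 + C (-(((j : ℕ) : ℝ) ^ 4)⁻¹) * X : ℝ⟦X⟧)))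
      atTop (𝓝 (coeff n quarticProd)) := by
  have h := tendsto_coeff_expand_prod_inv_four (2 * n)
  simp only [coeff_expand_mul] at h
  rwa [← coeff_even_rescale_sinhSeries_mul]

-- Odd coefficients need no computation: both sides are limits of the same series in X².
open PowerSeries in
theorem expand_quarticProd : expand 2 two_ne_zero quarticProd =
    rescale (Real.pi ^ 2) sinhSeries * rescale (-Real.pi ^ 2) sinhSeries := by
  ext n
  refine tendsto_nhds_unique ?_ (tendsto_coeff_expand_prod_inv_four n)
  simp_rw [coeff_expand]
  split_ifs
  · exact tendsto_coeff_prod_inv_four _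
  · exact tendsto_const_nhds

/-! ### Multiple zeta values as limits of symmetric sums -/

theorem mem_posTuples {n k : ℕ} {α : Fin k → ℕ} :
    α ∈ posTuples n k ↔ ∑ i, α i = n ∧ ∀ i, 0 < α i := by
  simp [posTuples]

-- Expanding the product picks one exponent per factor; `geomTail` has no constant term, so only
-- positive exponents survive.
open PowerSeries in
theorem coeff_prod_geomTail {k : ℕ} (n : ℕ) (s : Fin k ↪o ℕ+) :
    coeff n (∏ j ∈ Finset.univ.map s.toEmbedding, geomTail (((j : ℕ) : ℝ) ^ 4)⁻¹) =
      ∑ α ∈ posTuples n k, mzvTerm (fun i => 4 * α i) s := by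
  classical
  rw [Finset.prod_map, coeff_prod]
  symm
  refine Finset.sum_of_injOn (fun α => Finsupp.equivFunOnFinite.symm α) ?_ ?_ ?_ ?_
  · exact Finsupp.equivFunOnFinite.symm.injective.injOn
  · intro α hα
    simpa using (mem_posTuples.mp hα).1
  · intro l hl hl'
    rw [Finset.mem_finsuppAntidiag] at hl
    have : ∃ i, l i = 0 := by
      by_contra! h
      exact hl' ⟨l, mem_posTuples.mpr ⟨hl.1, fun i => Nat.pos_of_ne_zero (h i)⟩, by ext; rfl⟩
    obtain ⟨i, hi⟩ := this
    exact Finset.prod_eq_zero (Finset.mem_univ i) (by simp [geomTail, hi])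
  · intro α hα
    refine Finset.prod_congr rfl fun i _ => ?_
    have := (mem_posTuples.mp hα).2 i
    simp [geomTail, this.ne', pow_mul]

/-- Order embeddings of `Fin k` are finsets of cardinality `k`. -/
theorem hasSum_orderEmbedding_iff {ι : Type*} [LinearOrder ι] {k : ℕ} {g : Finset ι → ℝ} {L : ℝ} :
    HasSum (fun s : Fin k ↪o ι => g (Finset.univ.map s.toEmbedding)) L ↔
      HasSum (fun S => if S.card = k then g S else 0) L := by
  have hinj : Function.Injective fun s : Fin k ↪o ι => Finset.univ.map s.toEmbedding := by
    intro s t h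
    have hc : (Finset.univ.map s.toEmbedding).card = k := by simp
    rw [Finset.orderEmbOfFin_unique' hc (f := s) (by simp),
      Finset.orderEmbOfFin_unique' hc (f := t) fun i => ?_]
    simp only at h
    rw [h]; simp
  rw [← hinj.hasSum_iff]
  · simp [Function.comp_def]
  · intro S hS
    refine if_neg fun hc => hS ⟨S.orderEmbOfFin hc, ?_⟩
    exact Finset.map_orderEmbOfFin_univ S hc

/-- Comparison with the case of all exponents equal to 2. -/
theorem summable_mzvTerm {k : ℕ} {α : Fin k → ℕ} (hα : ∀ i, 2 ≤ α i) : Summable (mzvTerm α) := by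
  have hs : Summable fun S : Finset ℕ+ => ∏ j ∈ S, (((j : ℕ) : ℝ) ^ 2)⁻¹ :=
    summable_finsetProd_of_summable_nonneg (fun _ => by positivity) summable_inv_sq_pnat
  have hk : Summable fun S : Finset ℕ+ =>
      if S.card = k then ∏ j ∈ S, (((j : ℕ) : ℝ) ^ 2)⁻¹ else 0 :=
    ⟨_, hasSum_prod_inv_sq k⟩
  have := (hasSum_orderEmbedding_iff.mpr hk.hasSum).summable
  refine this.of_nonneg_of_le (fun s => ?_) fun s => ?_
  · exact Finset.prod_nonneg fun i _ => by positivity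
  · rw [Finset.prod_map, mzvTerm]
    refine Finset.prod_le_prod (fun i _ => by positivity) fun i _ => ?_
    have h1 : (1 : ℝ) ≤ ((s i : ℕ) : ℝ) := by exact_mod_cast one_le (a := s i)
    exact inv_anti₀ (by positivity) (pow_le_pow_right₀ h1 (hα i))

theorem summable_mzvTerm_of_mem_posTuples {n k : ℕ} {α : Fin k → ℕ} (hα : α ∈ posTuples n k) :
    Summable (mzvTerm fun i => 4 * α i) :=
  summable_mzvTerm fun i => by have := (mem_posTuples.mp hα).2 i; omega

/-- The generating series of the sums `mzvSum 4 n k`. -/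
noncomputable def mzvSumSeries (k : ℕ) : PowerSeries ℝ := PowerSeries.mk fun n => mzvSum 4 n k

open PowerSeries in
theorem tendsto_coeff_sum_prod_geomTail (k n : ℕ) :
    Tendsto (fun U : Finset ℕ+ =>
        coeff n (∑ S ∈ U.powersetCard k, ∏ j ∈ S, geomTail (((j : ℕ) : ℝ) ^ 4)⁻¹))
      atTop (𝓝 (coeff n (mzvSumSeries k))) := by
  simp_rw [map_sum]
  apply tendsto_sum_powersetCard
  rw [← hasSum_orderEmbedding_iff]
  simp_rw [coeff_prod_geomTail, mzvSumSeries, coeff_mk, mzvSum]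
  exact hasSum_sum fun α hα => (summable_mzvTerm_of_mem_posTuples hα).hasSum

open PowerSeries in
theorem mzvSumSeries_mul_quarticProd (k : ℕ) :
    mzvSumSeries k * quarticProd =
      PowerSeries.mk fun m => (-1) ^ (m - k) * (m.choose k : ℝ) * ((-1) ^ m * coeff m quarticProd) := by
  ext m
  refine tendsto_nhds_unique
    (tendsto_coeff_mul (tendsto_coeff_sum_prod_geomTail k) tendsto_coeff_prod_inv_four m) ?_
  simp_rw [coeff_sum_prod_geomTail_mul, coeff_mk]
  refine Tendsto.const_mul _ ?_
  -- The sign (-1)^m turns the coefficient of ∏ (1 - x_j X) into e_m(x).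
  refine ((tendsto_coeff_prod_inv_four m).const_mul ((-1) ^ m)).congr fun U => ?_
  rw [coeff_prod_one_add_C_mul_X, Finset.mul_sum]
  refine Finset.sum_congr rfl fun S hS => ?_
  rw [Finset.prod_neg, (Finset.mem_powersetCard.mp hS).2, ← mul_assoc, ← mul_pow]
  simp

theorem theoremC (n k : ℕ) (hk : 1 ≤ k) (hkn : k ≤ n) :
    (∀ α ∈ posTuples n k, Summable (mzvTerm fun i => 4 * α i)) ∧
    mzvSum 4 n k =
      (2 : ℝ) ^ (2 * n + 1) * Real.pi ^ (4 * n) / ((4 * n + 2).factorial : ℝ) *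
        ∑ q ∈ Finset.range (n - k + 1),
          (-1 : ℝ) ^ (n - q - k) * ((n - q).choose k : ℝ) * ((4 * n + 2).choose (4 * q) : ℝ) *
            ∑ p ∈ Finset.HasAntidiagonal.antidiagonal (2 * q),
              ((4 * q).choose (2 * p.1) : ℝ) * (-1 : ℝ) ^ p.1 * (2 : ℝ) ^ (2 * q) *
                bernoulliHalf (2 * p.1) * bernoulliHalf (2 * p.2) := by
  refine ⟨fun α hα => summable_mzvTerm_of_mem_posTuples hα, ?_⟩
  have h := congrArg (· * quarticProdInv) (mzvSumSeries_mul_quarticProd k)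
  simp only [mul_assoc, quarticProd_mul_quarticProdInv expand_quarticProd, mul_one] at h
  have hn := congrArg (PowerSeries.coeff n) h
  rw [mzvSumSeries, PowerSeries.coeff_mk, mul_comm, PowerSeries.coeff_mul,
    Finset.Nat.sum_antidiagonal_eq_sum_range_succ_mk] at hn
  rw [hn, Finset.mul_sum]
  symm
  refine Finset.sum_subset_zero_on_sdiff ?_ ?_ ?_
  · intro q hq
    simp only [Finset.mem_range] at hq ⊢
    omega
  -- For q > n - k the binomial coefficient C(n-q, k) vanishes.
  · intro q hq
    simp only [Finset.mem_sdiff, Finset.mem_range] at hq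
    simp [Nat.choose_eq_zero_of_lt (show n - q < k by omega)]
  · intro q hq
    rw [Finset.mem_range] at hq
    rw [coeff_quarticProdInv, PowerSeries.coeff_mk, quarticProd, PowerSeries.coeff_mk,
      ← mul_assoc ((-1 : ℝ) ^ (n - q)), ← mul_pow, neg_one_mul, neg_neg, one_pow, one_mul]
    have hc := Nat.choose_mul_factorial_mul_factorial (show 4 * q ≤ 4 * n + 2 by omega)
    obtain ⟨r, rfl⟩ : ∃ r, n = q + r := ⟨n - q, by omega⟩
    rw [show 4 * (q + r) + 2 - 4 * q = 4 * r + 2 by omega] at hc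
    rw [Nat.add_sub_cancel_left, ← hc]
    generalize (∑ p ∈ Finset.HasAntidiagonal.antidiagonal (2 * q), (_ : ℝ)) = s
    have hch : ((4 * (q + r) + 2).choose (4 * q) : ℝ) ≠ 0 := by
      exact_mod_cast (Nat.choose_pos (by omega)).ne'
    generalize hch' : (4 * (q + r) + 2).choose (4 * q) = c at hch
    have h1 : ((4 * q).factorial : ℝ) ≠ 0 := by positivity
    have h2 : ((4 * r + 2).factorial : ℝ) ≠ 0 := by positivity
    push_cast
    field_simp
    ring
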